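/- Let $N\ge 3$. For points $x_1,\dots,x_N\in\mathbb R$ write $\mu_N(x_1,\dots,x_N)=N^{-1}\sum_{i=1}^N x_i$ for their barycentre, and let $\mathrm{ord}(x_1,\dots,x_N)=(x_{(1)},\dots,x_{(N)})$ be the same points listed in nondecreasing order of their distance $|x_{(i)}-\mu_N(x_1,\dots,x_N)|$ from the barycentre. Consider the process $\mathcal X_N(t)=(X_{(1)}(t),\dots,X_{(N)}(t))$, $t=0,1,2,\dots$, defined as follows: $\mathcal X_N(0)$ consists of $N$ (possibly random) almost surely distinct points of $[0,1]$, listed in barycentric order; and, for each $t\ge 0$, \[ \mathcal X_N(t+1)=\mathrm{ord}\bigl(X_{(1)}(t),\dots,X_{(N-1)}(t),U_{t+1}\bigr), \] where $U_{t+1}$ is uniformly distributed on $[0,1]$ and independent of $\sigma(\mathcal X_N(0),\dots,\mathcal X_N(t))$. Ties in distance may be broken in any (for instance random) way compatible with this independence. Let $\mathcal X_N^*(t)=X_{(N)}(t)$ denote the extreme point, and let \[ \pi_N(t)=\frac1t\,\#\bigl\{s\in\{1,\dots,t\}:\ \mathcal X_N^*(s)<\mu_N(\mathcal X_N(s))\bigr\}.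 \] Then there is a random variable $\xi_N$ with values in $[0,1]$ such that $(X_{(1)}(t),\dots,X_{(N-1)}(t))\to(\xi_N,\dots,\xi_N)$ almost surely as $t\to\infty$, and \[ \lim_{t\to\infty}\pi_N(t)=\xi_N\quad\text{almost surely.} \] -/

import Mathlib

open MeasureTheory ProbabilityTheory Filter Topology

namespace BeautyContest

/-- The barycentre (centre of mass) of the points `x 0, …, x (k - 1)` of the line. -/
noncomputable def barycentre {k : ℕ} (x : Fin k → ℝ) : ℝ :=
  (k : ℝ)⁻¹ * ∑ i, x i

/-- `y` lists the points of `x` (with multiplicity) in nondecreasing order of distance from their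
barycentre, i.e. `y = ord x`. The relation allows any order among points at equal distance, so
that every way of breaking ties, random or not, is covered. -/
def IsBarycentricOrder {k : ℕ} (x y : Fin k → ℝ) : Prop :=
  (∃ σ : Equiv.Perm (Fin k), y = x ∘ σ) ∧ Monotone fun i => |y i - barycentre x|

/-- The extreme point of a barycentrically ordered vector of `n + 1` points: its last entry. -/
def extreme {n : ℕ} (y : Fin (n + 1) → ℝ) : ℝ := y (Fin.last n)

/-- The core of a barycentrically ordered vector of `n + 1` points: its first `n` entries. -/
def core {n : ℕ} (y : Fin (n + 1) → ℝ) : Fin n → ℝ := fun i => y i.castSucc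

/-- The configuration `y` with its extreme point replaced by `u`. -/
def replaceExtreme {n : ℕ} (y : Fin (n + 1) → ℝ) (u : ℝ) : Fin (n + 1) → ℝ :=
  Function.update y (Fin.last n) u

/-- The sigma-algebra generated by `X 0, …, X t`. -/
abbrev history {Ω E : Type*} [MeasurableSpace E] (X : ℕ → Ω → E) (t : ℕ) : MeasurableSpace Ω :=
  ⨆ s ≤ t, MeasurableSpace.comap (X s) inferInstance

/-- `X` is the randomized beauty contest on `[0, 1]` with `N = n + 1` points, in which `U (t + 1)`
is the point inserted at time `t + 1` (the value `U 0` plays no role). `X t ω` is the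
barycentrically ordered configuration at time `t`. The initial configuration may be random. -/
structure IsBeautyContest {Ω : Type*} [MeasurableSpace Ω] (P : Measure Ω) {n : ℕ}
    (X : ℕ → Ω → Fin (n + 1) → ℝ) (U : ℕ → Ω → ℝ) : Prop where
  measurable_config : ∀ t, Measurable (X t)
  measurable_insert : ∀ t, Measurable (U (t + 1))
  /-- The initial points are distinct and lie in `[0, 1]`. -/
  initial_distinct : ∀ᵐ ω ∂P, Function.Injective (X 0 ω)
  initial_mem : ∀ᵐ ω ∂P, ∀ i, X 0 ω i ∈ Set.Icc (0 : ℝ) 1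
  /-- The initial points are listed in barycentric order. -/
  initial_order : ∀ᵐ ω ∂P, IsBarycentricOrder (X 0 ω) (X 0 ω)
  /-- The inserted points are uniform on `[0, 1]`, each independent of the past. -/
  insert_uniform : ∀ t, pdf.IsUniform (U (t + 1)) (Set.Icc (0 : ℝ) 1) P volume
  insert_indep : ∀ t,
    Indep (MeasurableSpace.comap (U (t + 1)) inferInstance) (history X t) P
  /-- At each step the extreme point is replaced by the new point, and the result is reordered. -/
  step : ∀ t, ∀ᵐ ω ∂P,
    IsBarycentricOrder (replaceExtreme (X t ω) (U (t + 1) ω)) (X (t + 1) ω)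

open Classical in
/-- The proportion of the times `1, …, t` at which the extreme point of the trajectory `x` lies
strictly to the left of the barycentre. -/
noncomputable def leftProportion {n : ℕ} (x : ℕ → Fin (n + 1) → ℝ) (t : ℕ) : ℝ :=
  (((Finset.Icc 1 t).filter fun s => extreme (x s) < barycentre (x s)).card : ℝ) / t

end BeautyContest

/-!
Measure the core by its spread `S`, the square root of the sum of the squared distances of its
points from their mean `m`. Removing the point farthest from the overall barycentre leaves the
subconfiguration with the least sum of squares, so `S` never increases (`spread_le`). An inserted
point within `S / (2 n)` of `m` contracts `S` by a fixed factor (`spread_le_of_near`), and a point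
farther than `(n + 1) S` from `m` becomes the extreme point and leaves the core alone
(`last_of_far`).

The first event has a conditional probability of at least a multiple of `S`, so the expected spread
decreases at each step by at least a multiple of `E[S ^ 2]`; telescoping gives `∑ E[S ^ 2] < ∞`
(`tsum_lintegral_spread_sq_ne_top`), whence `S → 0`. The mean `m` moves only outside the second
event, hence with a conditional probability of at most a multiple of `S`, and then by at most a
multiple of `S`. Its expected displacement is therefore bounded by a multiple of the same summable
`E[S ^ 2]`, and `m` has almost surely finite total variation. So `m` converges to some `ξ`, and the
whole core with it.

For the proportion, fix rationals `a < ξ < b`. Once `m` is near `ξ` and `S` is small, an inserted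
point below `a` becomes extreme on the left, and one above `b` becomes extreme on the right. The
proportion is thus caught, in the limit, between the frequencies of inserted points below `a` and
below `b`, which the strong law of large numbers gives simultaneously for all rational levels
(`tendsto_leftProportion`). The inserted points are assumed independent of the past configurations
only; since each is almost surely determined by two consecutive configurations, they are pairwise
independent (`pairwise_indepFun_insert`), which suffices for the strong law.
-/

namespace BeautyContest

/-! ### One step of the contest -/

/-- The barycentre of the core. -/
noncomputable def coreMean {n : ℕ} (y : Fin (n + 1) → ℝ) : ℝ := barycentre (core y)

/-- The spread of the core: the square root of the sum of the squared distances of the core points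
from their barycentre. -/
noncomputable def spread {n : ℕ} (y : Fin (n + 1) → ℝ) : ℝ :=
  √(∑ i, (core y i - coreMean y) ^ 2)

/-- The sum of the squared distances, from their own barycentre, of the points of `w` other than
`w k` (see `spread_sq`), written in terms of the barycentre of all the points. In this form it is
plain that it is least when `w k` is the point farthest from the barycentre of `w`. -/
noncomputable def sqDevWithout {n : ℕ} (w : Fin (n + 1) → ℝ) (k : Fin (n + 1)) : ℝ :=
  ∑ l, (w l - barycentre w) ^ 2 - (1 + 1 / (n : ℝ)) * (w k - barycentre w) ^ 2

section Deterministic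

variable {n : ℕ}

lemma spread_nonneg (y : Fin (n + 1) → ℝ) : 0 ≤ spread y := Real.sqrt_nonneg _

lemma card_mul_barycentre {k : ℕ} (hk : 0 < k) (x : Fin k → ℝ) :
    k * barycentre x = ∑ i, x i := by
  have : (k : ℝ) ≠ 0 := by positivity
  simp [barycentre, this]

lemma card_mul_coreMean (hn : 0 < n) (y : Fin (n + 1) → ℝ) :
    n * coreMean y = ∑ i, y i - y (Fin.last n) := by
  rw [coreMean, card_mul_barycentre hn, Fin.sum_univ_castSucc]
  simp [core]

/-- The parallel axis theorem. -/
lemma sum_sq_sub {k : ℕ} (hk : 0 < k) (x : Fin k → ℝ) (c : ℝ) :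
    ∑ i, (x i - c) ^ 2 = ∑ i, (x i - barycentre x) ^ 2 + k * (barycentre x - c) ^ 2 := by
  have h : ∀ i, (x i - c) ^ 2 = (x i - barycentre x) ^ 2
      + (2 * (barycentre x - c) * x i - 2 * (barycentre x - c) * barycentre x
        + (barycentre x - c) ^ 2) := fun i => by ring
  simp_rw [h, Finset.sum_add_distrib, Finset.sum_sub_distrib, ← Finset.mul_sum]
  rw [← card_mul_barycentre hk x]
  simp

lemma spread_sq (hn : 0 < n) (y : Fin (n + 1) → ℝ) :
    spread y ^ 2 = sqDevWithout y (Fin.last n) := by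
  have hn' : (n : ℝ) ≠ 0 := by positivity
  rw [spread, Real.sq_sqrt (by positivity), sqDevWithout]
  have h1 := sum_sq_sub hn (core y) (barycentre y)
  have h2 := card_mul_coreMean hn y
  have h3 := card_mul_barycentre n.succ_pos y
  have h4 : ∑ l, (y l - barycentre y) ^ 2
      = ∑ i, (core y i - barycentre y) ^ 2 + (y (Fin.last n) - barycentre y) ^ 2 :=
    Fin.sum_univ_castSucc _
  push_cast at h3
  have h5 : coreMean y - barycentre y = -(y (Fin.last n) - barycentre y) / n := by
    field_simp
    linarith
  rw [h4, h1, show barycentre (core y) = coreMean y from rfl, h5]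
  field_simp
  ring

/-- The squared deviations of the points other than `w k` have their least sum when taken from
the barycentre of these points. -/
lemma sqDevWithout_le (hn : 0 < n) (w : Fin (n + 1) → ℝ) (k : Fin (n + 1)) (c : ℝ) :
    sqDevWithout w k ≤ ∑ l, (w l - c) ^ 2 - (w k - c) ^ 2 := by
  have hn' : (0 : ℝ) < n := by positivity
  rw [sqDevWithout, sum_sq_sub n.succ_pos w c]
  set b := barycentre w
  -- the difference of the two sides of the claim is this multiple of a square
  have : (n : ℝ) * ((b - c) - (w k - b) / n) ^ 2
      = n * (b - c) ^ 2 - 2 * (b - c) * (w k - b) + 1 / n * (w k - b) ^ 2 := by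
    field_simp
    ring
  have h0 : 0 ≤ (n : ℝ) * ((b - c) - (w k - b) / n) ^ 2 := by positivity
  push_cast
  nlinarith

lemma abs_core_sub_le (y : Fin (n + 1) → ℝ) (i : Fin n) :
    |core y i - coreMean y| ≤ spread y :=
  Real.abs_le_sqrt (Finset.single_le_sum (f := fun i => (core y i - coreMean y) ^ 2)
    (fun _ _ => sq_nonneg _) (Finset.mem_univ i))

lemma sum_replaceExtreme (h : ℝ → ℝ) (y : Fin (n + 1) → ℝ) (u : ℝ) :
    ∑ l, h (replaceExtreme y u l) = ∑ i, h (core y i) + h u := by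
  simp [Fin.sum_univ_castSucc, replaceExtreme, core, Function.update_of_ne,
    (Fin.castSucc_lt_last _).ne]

lemma replaceExtreme_last (y : Fin (n + 1) → ℝ) (u : ℝ) :
    replaceExtreme y u (Fin.last n) = u := by simp [replaceExtreme]

lemma replaceExtreme_castSucc (y : Fin (n + 1) → ℝ) (u : ℝ) (i : Fin n) :
    replaceExtreme y u i.castSucc = core y i := by
  simp [replaceExtreme, core, Function.update_of_ne, (Fin.castSucc_lt_last _).ne]

lemma barycentre_comp_perm {k : ℕ} (x : Fin k → ℝ) (σ : Equiv.Perm (Fin k)) :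
    barycentre (x ∘ σ) = barycentre x := by
  simp [barycentre, Equiv.sum_comp σ x]

lemma barycentre_replaceExtreme_sub (hn : 0 < n) (y : Fin (n + 1) → ℝ) (u : ℝ) :
    (n + 1) * (barycentre (replaceExtreme y u) - coreMean y) = u - coreMean y := by
  have h := card_mul_barycentre n.succ_pos (replaceExtreme y u)
  rw [sum_replaceExtreme (fun x => x) y u, ← card_mul_barycentre hn] at h
  push_cast at h
  rw [mul_sub, h, coreMean]
  ring

variable {y z : Fin (n + 1) → ℝ} {u : ℝ}

/-- The point removed from the core is the best one to remove: the new core has the least sum of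
squared deviations among all the `n`-point subconfigurations. -/
lemma spread_sq_le (hn : 0 < n) (h : IsBarycentricOrder (replaceExtreme y u) z)
    (k : Fin (n + 1)) (c : ℝ) :
    spread z ^ 2 ≤ ∑ i, (core y i - c) ^ 2 + (u - c) ^ 2 - (replaceExtreme y u k - c) ^ 2 := by
  rw [spread_sq hn, ← sum_replaceExtreme (fun x => (x - c) ^ 2) y u]
  refine le_trans ?_ (sqDevWithout_le hn _ k c)
  obtain ⟨⟨σ, rfl⟩, hm⟩ := h
  set w := replaceExtreme y u
  rw [sqDevWithout, sqDevWithout, barycentre_comp_perm]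
  have h1 : ∑ l, ((w ∘ σ) l - barycentre w) ^ 2 = ∑ l, (w l - barycentre w) ^ 2 :=
    Equiv.sum_comp σ fun l => (w l - barycentre w) ^ 2
  have h2 : |w k - barycentre w| ≤ |(w ∘ σ) (Fin.last n) - barycentre w| := by
    simpa using hm (Fin.le_last (σ.symm k))
  have h3 := sq_le_sq.2 h2
  rw [h1]
  gcongr

lemma spread_le (hn : 0 < n) (h : IsBarycentricOrder (replaceExtreme y u) z) :
    spread z ≤ spread y := by
  refine Real.le_sqrt_of_sq_le ?_
  simpa [replaceExtreme_last] using spread_sq_le hn h (Fin.last n) (coreMean y)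

/-- A point inserted close to the barycentre of the core contracts the core: the new core is at
least as good as the old one with its point farthest from the barycentre replaced. -/
lemma spread_le_of_near (hn : 0 < n) (h : IsBarycentricOrder (replaceExtreme y u) z)
    (hu : |u - coreMean y| ≤ spread y / (2 * n)) :
    spread z ≤ (1 - 1 / (4 * n)) * spread y := by
  have hn1 : (1 : ℝ) ≤ n := by exact_mod_cast hn
  have hS : ∑ i, (core y i - coreMean y) ^ 2 = spread y ^ 2 := by
    rw [spread, Real.sq_sqrt (by positivity)]
  -- some core point carries at least the average squared deviation; it is the one to compare with
  obtain ⟨i, -, hi⟩ : ∃ i ∈ (Finset.univ : Finset (Fin n)),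
      spread y ^ 2 / n ≤ (core y i - coreMean y) ^ 2 := by
    have : Nonempty (Fin n) := ⟨⟨0, hn⟩⟩
    refine Finset.exists_le_of_sum_le Finset.univ_nonempty ?_
    rw [hS]
    simp only [Finset.sum_const, Finset.card_univ, Fintype.card_fin, nsmul_eq_mul]
    rw [mul_div_cancel₀]
    positivity
  have h1 := spread_sq_le hn h i.castSucc (coreMean y)
  rw [hS, replaceExtreme_castSucc] at h1
  have h2 : (u - coreMean y) ^ 2 ≤ (spread y / (2 * n)) ^ 2 :=
    sq_le_sq' (abs_le.1 hu).1 (abs_le.1 hu).2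
  have hc : 1 / (4 * (n : ℝ)) ≤ 1 := by
    rw [div_le_one (by positivity)]; linarith
  refine abs_le_of_sq_le_sq' ?_ (mul_nonneg (by linarith) (spread_nonneg y)) |>.2
  have h3 : spread y ^ 2 + (spread y / (2 * n)) ^ 2 - spread y ^ 2 / n
      = ((1 - 1 / (4 * n)) * spread y) ^ 2
        - spread y ^ 2 * (8 * n - 3) / (16 * (n : ℝ) ^ 2) := by
    field_simp
    ring
  have h4 : 0 ≤ spread y ^ 2 * (8 * n - 3) / (16 * (n : ℝ) ^ 2) :=
    div_nonneg (mul_nonneg (sq_nonneg _) (by linarith)) (by positivity)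
  linarith

/-- A point inserted far from the core becomes the extreme point. This is where at least three
points are needed: two points are always at the same distance from their barycentre. -/
lemma last_of_far (hn : 2 ≤ n) {σ : Equiv.Perm (Fin (n + 1))}
    (hm : Monotone fun i => |(replaceExtreme y u ∘ σ) i - barycentre (replaceExtreme y u)|)
    (hu : (n + 1) * spread y < |u - coreMean y|) : σ (Fin.last n) = Fin.last n := by
  have hn2 : (2 : ℝ) ≤ n := by exact_mod_cast hn
  refine (σ (Fin.last n)).eq_castSucc_or_eq_last.resolve_left ?_
  rintro ⟨i, hi⟩
  have h1 := hm (Fin.le_last (σ.symm (Fin.last n)))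
  simp only [Function.comp, Equiv.apply_symm_apply, hi, replaceExtreme_last,
    replaceExtreme_castSucc] at h1
  have h2 := barycentre_replaceExtreme_sub (by omega) y u
  set b := barycentre (replaceExtreme y u)
  have h3 := abs_core_sub_le y i
  have h4 : u - coreMean y = (n + 1) * (b - coreMean y) := h2.symm
  have h5 : u - b = n * (b - coreMean y) := by linarith
  rw [h5, abs_mul, abs_of_nonneg (by positivity : (0 : ℝ) ≤ n)] at h1
  rw [h4, abs_mul, abs_of_nonneg (by positivity : (0 : ℝ) ≤ (n : ℝ) + 1)] at hu
  have h6 : |core y i - b| ≤ spread y + |b - coreMean y| := by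
    calc |core y i - b| ≤ |core y i - coreMean y| + |coreMean y - b| := abs_sub_le _ _ _
      _ ≤ _ := by rw [abs_sub_comm (coreMean y)]; gcongr
  have h7 : spread y < |b - coreMean y| := lt_of_mul_lt_mul_left hu (by positivity)
  nlinarith [mul_le_mul_of_nonneg_right hn2 (abs_nonneg (b - coreMean y))]

/-- The barycentre of the core moves only if the inserted point is within reach of the core, and
then by a bounded multiple of the spread. -/
lemma abs_coreMean_sub_le (hn : 2 ≤ n) (h : IsBarycentricOrder (replaceExtreme y u) z) :
    |coreMean z - coreMean y|
      ≤ if |u - coreMean y| ≤ (n + 1) * spread y then (n + 2) * spread y else 0 := by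
  have hn1 : (1 : ℝ) ≤ n := by exact_mod_cast (by omega : 1 ≤ n)
  obtain ⟨⟨σ, rfl⟩, hm⟩ := h
  have hz := card_mul_coreMean (by omega) (replaceExtreme y u ∘ σ)
  have hs : ∑ i, (replaceExtreme y u ∘ σ) i = ∑ i, core y i + u :=
    (Equiv.sum_comp σ _).trans (sum_replaceExtreme (fun x => x) y u)
  have hy : n * coreMean y = ∑ i, core y i := card_mul_barycentre (by omega) _
  rw [hs, ← hy] at hz
  set z := replaceExtreme y u ∘ σ
  have hd : n * (coreMean z - coreMean y) = u - z (Fin.last n) := by rw [mul_sub, hz]; ring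
  split_ifs with hu
  · have h1 : |u - z (Fin.last n)| ≤ (n + 2) * spread y := by
      have hS := spread_nonneg y
      simp only [z, Function.comp]
      rcases (σ (Fin.last n)).eq_castSucc_or_eq_last with ⟨i, hi⟩ | hi
      · rw [hi, replaceExtreme_castSucc]
        calc |u - core y i| ≤ |u - coreMean y| + |coreMean y - core y i| := abs_sub_le _ _ _
          _ ≤ (n + 1) * spread y + spread y := by
            rw [abs_sub_comm (coreMean y)]
            gcongr
            exact abs_core_sub_le y i
          _ = _ := by ring
      · rw [hi, replaceExtreme_last, sub_self, abs_zero]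
        positivity
    rw [← hd, abs_mul, abs_of_nonneg (by positivity : (0 : ℝ) ≤ n)] at h1
    exact (le_mul_of_one_le_left (abs_nonneg _) hn1).trans h1
  · have h1 := last_of_far hn hm (not_le.1 hu)
    have h2 : z (Fin.last n) = u := by simp [z, h1, replaceExtreme_last]
    rw [h2, sub_self] at hd
    have := (mul_eq_zero.1 hd).resolve_left (by positivity)
    simp [this]

/-- The side of the extreme point is that of the inserted point, unless the latter is within reach
of the core. -/
lemma extreme_lt_barycentre_iff (hn : 2 ≤ n) (h : IsBarycentricOrder (replaceExtreme y u) z)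
    (hu : (n + 1) * spread y < |u - coreMean y|) :
    extreme z < barycentre z ↔ u < coreMean y := by
  obtain ⟨⟨σ, rfl⟩, hm⟩ := h
  have h1 := last_of_far hn hm hu
  have h2 := barycentre_replaceExtreme_sub (by omega) y u
  have hn2 : (2 : ℝ) ≤ n := by exact_mod_cast hn
  rw [barycentre_comp_perm, extreme, Function.comp, h1, replaceExtreme_last]
  constructor <;> intro h <;> nlinarith

lemma mem_Icc_of_isBarycentricOrder (h : IsBarycentricOrder (replaceExtreme y u) z)
    (hy : ∀ i, y i ∈ Set.Icc (0 : ℝ) 1) (hu : u ∈ Set.Icc (0 : ℝ) 1) (i : Fin (n + 1)) :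
    z i ∈ Set.Icc (0 : ℝ) 1 := by
  obtain ⟨⟨σ, rfl⟩, -⟩ := h
  rcases (σ i).eq_castSucc_or_eq_last with ⟨j, hj⟩ | hj
  · simpa [hj, replaceExtreme_castSucc, core] using hy j.castSucc
  · simpa [hj, replaceExtreme_last] using hu

lemma coreMean_mem (hn : 0 < n) (hy : ∀ i, y i ∈ Set.Icc (0 : ℝ) 1) :
    coreMean y ∈ Set.Icc (0 : ℝ) 1 := by
  have h := card_mul_barycentre hn (core y)
  have hn' : (0 : ℝ) < n := by positivity
  have h0 : 0 ≤ ∑ i, core y i := Finset.sum_nonneg fun i _ => (hy _).1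
  have h1 : ∑ i, core y i ≤ n := by
    simpa [core] using Finset.sum_le_sum fun (i : Fin n) (_ : i ∈ Finset.univ) => (hy i.castSucc).2
  rw [← h] at h0 h1
  exact ⟨nonneg_of_mul_nonneg_right h0 hn',
    le_of_mul_le_mul_left (h1.trans_eq (mul_one _).symm) hn'⟩

lemma spread_le_card (hn : 0 < n) (hy : ∀ i, y i ∈ Set.Icc (0 : ℝ) 1) : spread y ≤ n := by
  have hm := coreMean_mem hn hy
  have h1 : ∑ i, (core y i - coreMean y) ^ 2 ≤ n := by
    have : ∀ i ∈ (Finset.univ : Finset (Fin n)), (core y i - coreMean y) ^ 2 ≤ 1 := fun i _ => by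
      have hi : core y i ∈ Set.Icc (0 : ℝ) 1 := hy i.castSucc
      rw [sq_le_one_iff_abs_le_one, abs_le]
      constructor <;> linarith [hi.1, hi.2, hm.1, hm.2]
    simpa using Finset.sum_le_sum this
  have hn1 : (1 : ℝ) ≤ n := by exact_mod_cast hn
  exact Real.sqrt_le_iff.2 ⟨by positivity, by nlinarith⟩

/-- The inserted point can be read off from two consecutive configurations. -/
lemma eq_sum_sub_sum (h : IsBarycentricOrder (replaceExtreme y u) z) :
    u = ∑ i, z i - ∑ i, core y i := by
  obtain ⟨⟨σ, rfl⟩, -⟩ := h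
  have : ∑ i, (replaceExtreme y u ∘ σ) i = ∑ i, core y i + u :=
    (Equiv.sum_comp σ _).trans (sum_replaceExtreme (fun x => x) y u)
  rw [this]
  ring

lemma measurable_coreMean : Measurable (coreMean : (Fin (n + 1) → ℝ) → ℝ) := by
  unfold coreMean barycentre core
  fun_prop

lemma measurable_spread : Measurable (spread : (Fin (n + 1) → ℝ) → ℝ) := by
  have := measurable_coreMean (n := n)
  unfold spread core
  fun_prop

end Deterministic

/-! ### The law of the inserted points -/

lemma measurable_history {Ω E : Type*} [MeasurableSpace E] {X : ℕ → Ω → E} {s t : ℕ}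
    (h : s ≤ t) : Measurable[history X t] (X s) :=
  Measurable.of_comap_le (le_iSup₂_of_le s h le_rfl)

section Law

variable {Ω : Type*} [MeasurableSpace Ω] {P : Measure Ω} {n : ℕ}
  {X : ℕ → Ω → Fin (n + 1) → ℝ} {U : ℕ → Ω → ℝ}

namespace IsBeautyContest

lemma map_insert (hX : IsBeautyContest P X U) (t : ℕ) :
    P.map (U (t + 1)) = volume.restrict (Set.Icc (0 : ℝ) 1) := by
  have := hX.insert_uniform t
  rw [pdf.IsUniform, ProbabilityTheory.cond] at this
  simpa using this

lemma ae_insert_mem (hX : IsBeautyContest P X U) :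
    ∀ᵐ ω ∂P, ∀ t, U (t + 1) ω ∈ Set.Icc (0 : ℝ) 1 := by
  refine ae_all_iff.2 fun t => ?_
  refine ae_of_ae_map (hX.measurable_insert t).aemeasurable ?_
  rw [hX.map_insert]
  exact ae_restrict_mem measurableSet_Icc

lemma ae_mem (hX : IsBeautyContest P X U) :
    ∀ᵐ ω ∂P, ∀ t i, X t ω i ∈ Set.Icc (0 : ℝ) 1 := by
  filter_upwards [hX.initial_mem, ae_all_iff.2 hX.step, hX.ae_insert_mem] with ω h0 hs hu t
  induction t with
  | zero => exact h0
  | succ t ih => exact mem_Icc_of_isBarycentricOrder (hs t) ih (hu t)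

lemma lintegral_config_insert [IsProbabilityMeasure P] (hX : IsBeautyContest P X U) (t : ℕ)
    {f : (Fin (n + 1) → ℝ) × ℝ → ENNReal} (hf : Measurable f) :
    ∫⁻ ω, f (X t ω, U (t + 1) ω) ∂P
      = ∫⁻ ω, (∫⁻ u in Set.Icc (0 : ℝ) 1, f (X t ω, u)) ∂P := by
  have hx := hX.measurable_config t
  have hu := hX.measurable_insert t
  have hi : IndepFun (X t) (U (t + 1)) P := by
    rw [IndepFun_iff_Indep]
    exact indep_of_indep_of_le_left (hX.insert_indep t).symm (measurable_history le_rfl).comap_le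
  rw [← lintegral_map (f := f) hf (hx.prodMk hu),
    (indepFun_iff_map_prod_eq_prod_map_map hx.aemeasurable hu.aemeasurable).1 hi,
    hX.map_insert, lintegral_prod _ hf.aemeasurable, lintegral_map hf.lintegral_prod_right' hx]

/-- Each inserted point is almost surely a function of two consecutive configurations, so the
independence of the past makes the inserted points pairwise independent. -/
lemma pairwise_indepFun_insert [IsProbabilityMeasure P] (hX : IsBeautyContest P X U) :
    Pairwise fun s t => IndepFun (U (s + 1)) (U (t + 1)) P := by
  have key : ∀ s t, s < t → IndepFun (U (s + 1)) (U (t + 1)) P := by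
    intro s t hst
    let V : Ω → ℝ := fun ω => ∑ i, X (s + 1) ω i - ∑ i, core (X s ω) i
    have hV : Measurable[history X t] V := by
      have h1 : Measurable[history X t] (X (s + 1)) := measurable_history hst
      have h2 : Measurable[history X t] (X s) := measurable_history hst.le
      have h3 : Measurable fun y : Fin (n + 1) → ℝ => ∑ i, y i := by fun_prop
      have h4 : Measurable fun y : Fin (n + 1) → ℝ => ∑ i, core y i := by
        unfold core; fun_prop
      exact (h3.comp h1).sub (h4.comp h2)
    have hVU : V =ᵐ[P] U (s + 1) := by
      filter_upwards [hX.step s] with ω h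
      exact (eq_sum_sub_sum h).symm
    refine IndepFun.congr (f := V) (g := U (t + 1)) ?_ hVU (ae_eq_refl _)
    rw [IndepFun_iff_Indep]
    exact indep_of_indep_of_le_left (hX.insert_indep t).symm hV.comap_le
  intro s t hst
  rcases lt_or_gt_of_ne hst with h | h
  · exact key s t h
  · exact (key t s h).symm

/-- The law of large numbers for the inserted points to the left of a fixed level `q`. -/
lemma ae_tendsto_average_insert [IsProbabilityMeasure P] (hX : IsBeautyContest P X U) (q : ℝ) :
    ∀ᵐ ω ∂P, Tendsto
      (fun t : ℕ => (∑ i ∈ Finset.range t, (Set.Iio q).indicator (1 : ℝ → ℝ) (U (i + 1) ω)) / t)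
      atTop (𝓝 ((volume.restrict (Set.Icc (0 : ℝ) 1)).real (Set.Iio q))) := by
  have hq : Measurable ((Set.Iio q).indicator (1 : ℝ → ℝ)) :=
    measurable_one.indicator measurableSet_Iio
  have h := strong_law_ae_real
    (fun i ω => (Set.Iio q).indicator (1 : ℝ → ℝ) (U (i + 1) ω)) (μ := P)
    ?_ (fun s t hst => (hX.pairwise_indepFun_insert hst).comp hq hq) fun i => ?_
  · have he : ∫ ω, (Set.Iio q).indicator (1 : ℝ → ℝ) (U (0 + 1) ω) ∂P
        = (volume.restrict (Set.Icc (0 : ℝ) 1)).real (Set.Iio q) := by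
      rw [← integral_map (f := (Set.Iio q).indicator (1 : ℝ → ℝ))
        (hX.measurable_insert 0).aemeasurable hq.aestronglyMeasurable,
        hX.map_insert, integral_indicator_one measurableSet_Iio]
    simpa only [he] using h
  · refine Integrable.of_bound (hq.comp (hX.measurable_insert 0)).aestronglyMeasurable 1
      (ae_of_all _ fun ω => ?_)
    by_cases hω : U (0 + 1) ω ∈ Set.Iio q <;> simp [Set.indicator, hω]
  · refine IdentDistrib.comp (u := (Set.Iio q).indicator (1 : ℝ → ℝ)) ?_ hq
    exact ⟨(hX.measurable_insert i).aemeasurable, (hX.measurable_insert 0).aemeasurable,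
      by rw [hX.map_insert, hX.map_insert]⟩

end IsBeautyContest

lemma le_uniform_Iio {a : ℝ} (ha : a ≤ 1) :
    a ≤ (volume.restrict (Set.Icc (0 : ℝ) 1)).real (Set.Iio a) := by
  rw [measureReal_restrict_apply measurableSet_Iio]
  have h : volume.real (Set.Ico 0 a) ≤ volume.real (Set.Iio a ∩ Set.Icc 0 1) :=
    measureReal_mono (fun x hx => ⟨hx.2, hx.1, hx.2.le.trans ha⟩)
      (measure_ne_top_of_subset Set.inter_subset_right (by simp))
  refine le_trans ?_ h
  simp

lemma uniform_Iio_le {b : ℝ} (hb : 0 ≤ b) :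
    (volume.restrict (Set.Icc (0 : ℝ) 1)).real (Set.Iio b) ≤ b := by
  rw [measureReal_restrict_apply measurableSet_Iio]
  have h : volume.real (Set.Iio b ∩ Set.Icc 0 1) ≤ volume.real (Set.Icc 0 b) :=
    measureReal_mono (fun x hx => ⟨hx.2.1, hx.1.le⟩) (by simp)
  simpa [hb] using h

end Law

/-! ### The core shrinks and its barycentre converges -/

section Convergence

lemma lintegral_near_le (m r : ℝ) (C : ENNReal) :
    ∫⁻ u in Set.Icc (0 : ℝ) 1, (if |u - m| ≤ r then C else 0) ≤ C * ENNReal.ofReal (2 * r) := by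
  have h : ∀ u, (if |u - m| ≤ r then C else 0)
      = (Set.Icc (m - r) (m + r)).indicator (fun _ => C) u := by
    intro u
    rw [Set.indicator_apply]
    congr 1
    rw [abs_le, Set.mem_Icc, eq_iff_iff]
    constructor <;> rintro ⟨h1, h2⟩ <;> constructor <;> linarith
  simp_rw [h]
  refine (setLIntegral_le_lintegral _ _).trans ?_
  rw [lintegral_indicator_const measurableSet_Icc, Real.volume_Icc]
  gcongr
  linarith

/-- At least half of a short interval around a point of `[0, 1]` lies in `[0, 1]`. -/
lemma le_lintegral_near {m r : ℝ} (hm : m ∈ Set.Icc (0 : ℝ) 1) (hr : 0 ≤ r) (hr' : r ≤ 1 / 2)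
    (C : ENNReal) :
    C * ENNReal.ofReal r ≤ ∫⁻ u in Set.Icc (0 : ℝ) 1, (if |u - m| ≤ r then C else 0) := by
  obtain ⟨a, ha, hsub⟩ : ∃ a, Set.Icc a (a + r) ⊆ Set.Icc 0 1 ∧
      ∀ u ∈ Set.Icc a (a + r), |u - m| ≤ r := by
    rcases le_total m (1 / 2) with h | h
    · exact ⟨m, Set.Icc_subset_Icc hm.1 (by linarith), fun u hu => by
        rw [abs_le]; constructor <;> linarith [hu.1, hu.2]⟩
    · exact ⟨m - r, Set.Icc_subset_Icc (by linarith) (by linarith [hm.2]), fun u hu => by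
        rw [abs_le]; constructor <;> linarith [hu.1, hu.2]⟩
  calc C * ENNReal.ofReal r = ∫⁻ _ in Set.Icc a (a + r), C := by
        rw [setLIntegral_const, Real.volume_Icc]; congr 2; ring
    _ = ∫⁻ u in Set.Icc a (a + r), (if |u - m| ≤ r then C else 0) :=
        setLIntegral_congr_fun measurableSet_Icc fun u hu => by simp [hsub u hu]
    _ ≤ _ := lintegral_mono_set ha

lemma ae_summable_of_tsum_lintegral_ne_top {Ω : Type*} [MeasurableSpace Ω] {P : Measure Ω}
    {g : ℕ → Ω → ℝ} (hg : ∀ t, Measurable (g t)) (h0 : ∀ t ω, 0 ≤ g t ω)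
    (h : ∑' t, ∫⁻ ω, ENNReal.ofReal (g t ω) ∂P ≠ ⊤) : ∀ᵐ ω ∂P, Summable fun t => g t ω := by
  rw [← lintegral_tsum fun t => (hg t).ennreal_ofReal.aemeasurable] at h
  filter_upwards [ae_lt_top' (AEMeasurable.tsum
    fun t => (hg t).ennreal_ofReal.aemeasurable) h] with ω hω
  simpa [ENNReal.toReal_ofReal, h0] using ENNReal.summable_toReal hω.ne

variable {Ω : Type*} [MeasurableSpace Ω] {P : Measure Ω} [IsProbabilityMeasure P] {n : ℕ}
  {X : ℕ → Ω → Fin (n + 1) → ℝ} {U : ℕ → Ω → ℝ}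

lemma measurable_near (a : ℝ) : Measurable fun p : (Fin (n + 1) → ℝ) × ℝ =>
    if |p.2 - coreMean p.1| ≤ a * spread p.1 then ENNReal.ofReal (spread p.1) else 0 := by
  have h1 := measurable_coreMean (n := n)
  have h2 := measurable_spread (n := n)
  refine Measurable.ite (measurableSet_le ?_ ?_) ?_ measurable_const <;> fun_prop

namespace IsBeautyContest

/-- The expected spread decreases in one step by at least a multiple of the expected squared
spread: the inserted point contracts the core by a fixed factor as soon as it falls near the
barycentre, which has a conditional probability proportional to the spread. -/
lemma lintegral_spread_succ_add_le (hn : 2 ≤ n) (hX : IsBeautyContest P X U) (t : ℕ) :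
    ∫⁻ ω, ENNReal.ofReal (spread (X (t + 1) ω)) ∂P
      + ENNReal.ofReal (1 / (4 * n) * (1 / (2 * n)))
        * ∫⁻ ω, ENNReal.ofReal (spread (X t ω) ^ 2) ∂P
      ≤ ∫⁻ ω, ENNReal.ofReal (spread (X t ω)) ∂P := by
  have hn0 : 0 < n := by omega
  have hx := hX.measurable_config
  have hS := measurable_spread (n := n)
  have hf := measurable_near (n := n) (1 / (2 * n))
  have h1 : ENNReal.ofReal (1 / (2 * n)) * ∫⁻ ω, ENNReal.ofReal (spread (X t ω) ^ 2) ∂P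
      ≤ ∫⁻ ω, (if |U (t + 1) ω - coreMean (X t ω)| ≤ 1 / (2 * n) * spread (X t ω)
        then ENNReal.ofReal (spread (X t ω)) else 0) ∂P := by
    rw [hX.lintegral_config_insert t hf, ← lintegral_const_mul _ (by fun_prop)]
    refine lintegral_mono_ae ?_
    filter_upwards [hX.ae_mem] with ω hω
    have hs0 := spread_nonneg (X t ω)
    refine le_trans (le_of_eq ?_) (le_lintegral_near (coreMean_mem hn0 (hω t)) (by positivity) ?_ _)
    · rw [← ENNReal.ofReal_mul (by positivity), ← ENNReal.ofReal_mul (by positivity)]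
      congr 1
      ring
    · have h2 := spread_le_card hn0 (hω t)
      rw [div_mul_eq_mul_div, div_le_div_iff₀ (by positivity) (by norm_num)]
      linarith
  rw [ENNReal.ofReal_mul (by positivity), mul_assoc]
  calc _ ≤ ∫⁻ ω, ENNReal.ofReal (spread (X (t + 1) ω)) ∂P + ENNReal.ofReal (1 / (4 * n))
        * ∫⁻ ω, (if |U (t + 1) ω - coreMean (X t ω)| ≤ 1 / (2 * n) * spread (X t ω)
        then ENNReal.ofReal (spread (X t ω)) else 0) ∂P := by gcongr
    _ = ∫⁻ ω, (ENNReal.ofReal (spread (X (t + 1) ω)) + ENNReal.ofReal (1 / (4 * n))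
        * (if |U (t + 1) ω - coreMean (X t ω)| ≤ 1 / (2 * n) * spread (X t ω)
        then ENNReal.ofReal (spread (X t ω)) else 0)) ∂P := by
      rw [lintegral_add_left (by fun_prop), lintegral_const_mul]
      exact hf.comp ((hx t).prodMk (hX.measurable_insert t))
    _ ≤ _ := by
      refine lintegral_mono_ae ?_
      filter_upwards [hX.step t] with ω hω
      split_ifs with hu
      · have h2 := spread_le_of_near hn0 hω (by rwa [div_mul_eq_mul_div, one_mul] at hu)
        rw [← ENNReal.ofReal_mul (by positivity),
          ← ENNReal.ofReal_add (spread_nonneg _) (mul_nonneg (by positivity) (spread_nonneg _))]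
        exact ENNReal.ofReal_le_ofReal (by linarith)
      · simpa using ENNReal.ofReal_le_ofReal (spread_le hn0 hω)

lemma tsum_lintegral_spread_sq_ne_top (hn : 2 ≤ n) (hX : IsBeautyContest P X U) :
    ∑' t, ∫⁻ ω, ENNReal.ofReal (spread (X t ω) ^ 2) ∂P ≠ ⊤ := by
  set c : ENNReal := ENNReal.ofReal (1 / (4 * n) * (1 / (2 * n)))
  set d : ℕ → ENNReal := fun t => ∫⁻ ω, ENNReal.ofReal (spread (X t ω)) ∂P
  set E : ℕ → ENNReal := fun t => ∫⁻ ω, ENNReal.ofReal (spread (X t ω) ^ 2) ∂P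
  have hsum : ∀ T, d T + ∑ t ∈ Finset.range T, c * E t ≤ d 0 := by
    intro T
    induction T with
    | zero => simp
    | succ T ih =>
      rw [Finset.sum_range_succ, add_comm (∑ t ∈ _, _), ← add_assoc]
      exact le_trans (by gcongr; exact hX.lintegral_spread_succ_add_le hn T) ih
  have hd : d 0 ≠ ⊤ := by
    refine ne_top_of_le_ne_top (b := ∫⁻ _, ENNReal.ofReal n ∂P) (by simp) (lintegral_mono_ae ?_)
    filter_upwards [hX.ae_mem] with ω hω
    exact ENNReal.ofReal_le_ofReal (spread_le_card (by omega) (hω 0))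
  have h1 : c * ∑' t, E t ≤ d 0 := by
    rw [← ENNReal.tsum_mul_left]
    exact ENNReal.tsum_le_of_sum_range_le fun T => le_add_self.trans (hsum T)
  have hc : c ≠ 0 := by
    have : 0 < n := by omega
    simp only [c, ne_eq, ENNReal.ofReal_eq_zero, not_le]
    positivity
  intro h
  rw [h, ENNReal.mul_top hc] at h1
  exact hd (top_le_iff.1 h1)

/-- The squared spread is also a bound for the expected displacement of the barycentre of the core:
the displacement is of the order of the spread, and so is the probability that it is not zero. -/
lemma lintegral_abs_coreMean_sub_le (hn : 2 ≤ n) (hX : IsBeautyContest P X U) (t : ℕ) :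
    ∫⁻ ω, ENNReal.ofReal |coreMean (X (t + 1) ω) - coreMean (X t ω)| ∂P
      ≤ ENNReal.ofReal ((n + 2) * (2 * (n + 1)))
        * ∫⁻ ω, ENNReal.ofReal (spread (X t ω) ^ 2) ∂P := by
  have hx := hX.measurable_config
  have hS := measurable_spread (n := n)
  have hf := measurable_near (n := n) (n + 1)
  calc _ ≤ ∫⁻ ω, (ENNReal.ofReal (n + 2)
        * (if |U (t + 1) ω - coreMean (X t ω)| ≤ (n + 1) * spread (X t ω)
        then ENNReal.ofReal (spread (X t ω)) else 0)) ∂P := by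
        refine lintegral_mono_ae ?_
        filter_upwards [hX.step t] with ω hω
        have h := abs_coreMean_sub_le hn hω
        split_ifs at h ⊢ with hu
        · rw [← ENNReal.ofReal_mul (by positivity)]
          exact ENNReal.ofReal_le_ofReal h
        · simpa using h
    _ = ENNReal.ofReal (n + 2) * ∫⁻ ω, (∫⁻ u in Set.Icc (0 : ℝ) 1,
        (if |u - coreMean (X t ω)| ≤ (n + 1) * spread (X t ω)
        then ENNReal.ofReal (spread (X t ω)) else 0)) ∂P := by
      rw [← hX.lintegral_config_insert t hf, lintegral_const_mul]
      exact hf.comp ((hx t).prodMk (hX.measurable_insert t))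
    _ ≤ ENNReal.ofReal (n + 2) * ∫⁻ ω, ENNReal.ofReal (spread (X t ω))
        * ENNReal.ofReal (2 * ((n + 1) * spread (X t ω))) ∂P := by
      gcongr with ω
      exact lintegral_near_le _ _ _
    _ = _ := by
      rw [ENNReal.ofReal_mul (by positivity), mul_assoc,
        ← lintegral_const_mul (ENNReal.ofReal (2 * (n + 1))) (by fun_prop)]
      congr 2 with ω
      have hs0 := spread_nonneg (X t ω)
      rw [← ENNReal.ofReal_mul (by positivity), ← ENNReal.ofReal_mul (by positivity)]
      congr 1
      ring

lemma ae_tendsto_spread (hn : 2 ≤ n) (hX : IsBeautyContest P X U) :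
    ∀ᵐ ω ∂P, Tendsto (fun t => spread (X t ω)) atTop (𝓝 0) := by
  have hS := measurable_spread (n := n)
  filter_upwards [ae_summable_of_tsum_lintegral_ne_top
    (fun t => (hS.comp (hX.measurable_config t)).pow_const 2) (fun _ _ => sq_nonneg _)
    (hX.tsum_lintegral_spread_sq_ne_top hn)] with ω hω
  have h := hω.tendsto_atTop_zero.sqrt
  simpa [Real.sqrt_sq, spread_nonneg] using h

lemma ae_exists_tendsto_coreMean (hn : 2 ≤ n) (hX : IsBeautyContest P X U) :
    ∀ᵐ ω ∂P, ∃ x, Tendsto (fun t => coreMean (X t ω)) atTop (𝓝 x) := by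
  have hm := measurable_coreMean (n := n)
  have hx := hX.measurable_config
  have h : ∑' t, ∫⁻ ω, ENNReal.ofReal |coreMean (X (t + 1) ω) - coreMean (X t ω)| ∂P ≠ ⊤ := by
    refine ne_top_of_le_ne_top ?_
      (ENNReal.tsum_le_tsum fun t => hX.lintegral_abs_coreMean_sub_le hn t)
    rw [ENNReal.tsum_mul_left]
    exact ENNReal.mul_ne_top ENNReal.ofReal_ne_top (hX.tsum_lintegral_spread_sq_ne_top hn)
  filter_upwards [ae_summable_of_tsum_lintegral_ne_top
    (fun t => by fun_prop) (fun _ _ => abs_nonneg _) h] with ω hω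
  refine cauchySeq_tendsto_of_complete (cauchySeq_of_summable_dist ?_)
  simpa [Real.dist_eq, abs_sub_comm] using hω

end IsBeautyContest

end Convergence

/-! ### The side of the extreme point -/

section Proportion

lemma leftProportion_eq {n : ℕ} (x : ℕ → Fin (n + 1) → ℝ) (t : ℕ) :
    leftProportion x t
      = (∑ i ∈ Finset.range t,
        {y : Fin (n + 1) → ℝ | extreme y < barycentre y}.indicator 1 (x (i + 1))) / t := by
  classical
  rw [leftProportion, Finset.card_filter, Finset.range_eq_Ico, Finset.sum_Ico_add' (fun s =>
    {y : Fin (n + 1) → ℝ | extreme y < barycentre y}.indicator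
      (1 : (Fin (n + 1) → ℝ) → ℝ) (x s)) 0 t 1]
  push_cast
  simp only [Set.indicator_apply, Set.mem_ofPred_eq, Pi.one_apply]
  congr 1

/-- If `a ≤ l` from some time on, then the averages of `l` are in the limit at least those
of `a`. -/
lemma eventually_lt_average {a l : ℕ → ℝ} {A B : ℝ} (hal : ∀ᶠ i in atTop, a i ≤ l i)
    (ha : Tendsto (fun t : ℕ => (∑ i ∈ Finset.range t, a i) / t) atTop (𝓝 A)) (hB : B < A) :
    ∀ᶠ t : ℕ in atTop, B < (∑ i ∈ Finset.range t, l i) / t := by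
  -- the negative part of `l - a` vanishes eventually, so it averages to zero
  have h0 : Tendsto (fun i => min (l i - a i) 0) atTop (𝓝 0) :=
    tendsto_const_nhds.congr' (hal.mono fun i hi => (min_eq_right (sub_nonneg.2 hi)).symm)
  have h := ha.add h0.cesaro
  rw [add_zero] at h
  filter_upwards [h.eventually_const_lt hB] with t ht
  refine ht.trans_le ?_
  rw [inv_mul_eq_div, ← add_div, ← Finset.sum_add_distrib]
  gcongr with i
  linarith [min_le_left (l i - a i) 0]

lemma eventually_average_lt {b l : ℕ → ℝ} {A B : ℝ} (hlb : ∀ᶠ i in atTop, l i ≤ b i)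
    (hb : Tendsto (fun t : ℕ => (∑ i ∈ Finset.range t, b i) / t) atTop (𝓝 A)) (hB : A < B) :
    ∀ᶠ t : ℕ in atTop, (∑ i ∈ Finset.range t, l i) / t < B := by
  have := eventually_lt_average (a := fun i => -b i) (l := fun i => -l i) (A := -A) (B := -B)
    (hlb.mono fun i hi => neg_le_neg hi) (by simpa [neg_div] using hb.neg) (neg_lt_neg hB)
  simpa [neg_div] using this

/-- Along a trajectory whose core converges to `x`, inserted points at a fixed distance from `x`
eventually become extreme points on their own side, so the proportion of left extreme points is
caught between the frequencies of inserted points below levels near `x`. -/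
lemma tendsto_leftProportion {n : ℕ} (hn : 2 ≤ n) {y : ℕ → Fin (n + 1) → ℝ} {u : ℕ → ℝ} {x : ℝ}
    (hx : x ∈ Set.Icc (0 : ℝ) 1)
    (hstep : ∀ t, IsBarycentricOrder (replaceExtreme (y t) (u (t + 1))) (y (t + 1)))
    (hspread : Tendsto (fun t => spread (y t)) atTop (𝓝 0))
    (hmean : Tendsto (fun t => coreMean (y t)) atTop (𝓝 x))
    (hfreq : ∀ q : ℚ, Tendsto
      (fun t : ℕ => (∑ i ∈ Finset.range t, (Set.Iio (q : ℝ)).indicator (1 : ℝ → ℝ) (u (i + 1))) / t)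
      atTop (𝓝 ((volume.restrict (Set.Icc (0 : ℝ) 1)).real (Set.Iio (q : ℝ))))) :
    Tendsto (leftProportion y) atTop (𝓝 x) := by
  have hs : Tendsto (fun t => ((n : ℝ) + 1) * spread (y t)) atTop (𝓝 0) := by
    simpa using hspread.const_mul ((n : ℝ) + 1)
  rw [tendsto_order]
  simp_rw [leftProportion_eq]
  constructor
  · intro B hB
    obtain ⟨q, hBq, hqx⟩ := exists_rat_btwn hB
    refine eventually_lt_average ?_ (hfreq q) (hBq.trans_le (le_uniform_Iio (hqx.le.trans hx.2)))
    have hlim := hmean.sub hs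
    rw [sub_zero] at hlim
    filter_upwards [hlim.eventually_const_lt hqx] with t ht
    have h0 := spread_nonneg (y t)
    by_cases hu : u (t + 1) < q
    · have hleft : extreme (y (t + 1)) < barycentre (y (t + 1)) := by
        refine (extreme_lt_barycentre_iff hn (hstep t) ?_).2 (by nlinarith)
        rw [abs_sub_comm]
        exact lt_of_lt_of_le (by linarith) (le_abs_self _)
      simp [hu, hleft]
    · rw [Set.indicator_of_notMem (show u (t + 1) ∉ Set.Iio (q : ℝ) from hu)]
      exact Set.indicator_nonneg (fun _ _ => zero_le_one) _
  · intro B hB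
    obtain ⟨q, hxq, hqB⟩ := exists_rat_btwn hB
    refine eventually_average_lt ?_ (hfreq q) ((uniform_Iio_le (hx.1.trans hxq.le)).trans_lt hqB)
    have hlim := hmean.add hs
    rw [add_zero] at hlim
    filter_upwards [hlim.eventually_lt_const hxq] with t ht
    have h0 := spread_nonneg (y t)
    by_cases hu : u (t + 1) < q
    · rw [Set.indicator_of_mem (show u (t + 1) ∈ Set.Iio (q : ℝ) from hu)]
      exact Set.indicator_le_self' (fun _ _ => zero_le_one) _
    · have hright : ¬ extreme (y (t + 1)) < barycentre (y (t + 1)) := by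
        rw [extreme_lt_barycentre_iff hn (hstep t)
          (lt_of_lt_of_le (by linarith) (le_abs_self _))]
        nlinarith
      rw [Set.indicator_of_notMem (by exact hright)]
      exact Set.indicator_nonneg (fun _ _ => zero_le_one) _

end Proportion

end BeautyContest

/-- For `N = n + 1 ≥ 3` points there is a random `ξ` in `[0, 1]` to which all the points of the
core converge almost surely, and the proportion of times at which the extreme point is on the left
of the barycentre converges almost surely to that same `ξ`. -/
theorem mainTheorem2 {Ω : Type*} [MeasurableSpace Ω] (P : Measure Ω) [IsProbabilityMeasure P]
    (n : ℕ) (hN : 3 ≤ n + 1) (X : ℕ → Ω → Fin (n + 1) → ℝ) (U : ℕ → Ω → ℝ)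
    (hX : BeautyContest.IsBeautyContest P X U) :
    ∃ ξ : Ω → ℝ, Measurable ξ ∧ (∀ ω, ξ ω ∈ Set.Icc (0 : ℝ) 1) ∧
      (∀ᵐ ω ∂P, ∀ i : Fin n,
        Tendsto (fun t => BeautyContest.core (X t ω) i) atTop (𝓝 (ξ ω))) ∧
      (∀ᵐ ω ∂P,
        Tendsto (fun t => BeautyContest.leftProportion (fun s => X s ω) t) atTop (𝓝 (ξ ω))) := by
  have hn : 2 ≤ n := by omega
  have hm := BeautyContest.measurable_coreMean (n := n)
  have hx := hX.measurable_config
  -- truncating the limit superior makes `ξ` measurable and `[0, 1]`-valued on the whole of `Ω`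
  refine ⟨fun ω => max 0 (min 1 (limsup (fun t => BeautyContest.coreMean (X t ω)) atTop)),
    measurable_const.max (measurable_const.min (Measurable.limsup fun t => hm.comp (hx t))),
    fun ω => ⟨le_max_left _ _, max_le zero_le_one (min_le_left _ _)⟩, ?_⟩
  have hlim : ∀ᵐ ω ∂P, Tendsto (fun t => BeautyContest.coreMean (X t ω)) atTop
      (𝓝 (max 0 (min 1 (limsup (fun t => BeautyContest.coreMean (X t ω)) atTop)))) := by
    filter_upwards [hX.ae_exists_tendsto_coreMean hn, hX.ae_mem] with ω ⟨x, hx⟩ hω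
    have h01 : x ∈ Set.Icc (0 : ℝ) 1 := isClosed_Icc.mem_of_tendsto hx
      (Eventually.of_forall fun t => BeautyContest.coreMean_mem (by omega) (hω t))
    rwa [hx.limsup_eq, min_eq_right h01.2, max_eq_right h01.1]
  constructor
  · filter_upwards [hlim, hX.ae_tendsto_spread hn] with ω hω hs i
    have h0 : Tendsto (fun t => BeautyContest.core (X t ω) i - BeautyContest.coreMean (X t ω))
        atTop (𝓝 0) :=
      squeeze_zero_norm (fun t => BeautyContest.abs_core_sub_le (X t ω) i) hs
    simpa using h0.add hω
  · filter_upwards [hlim, hX.ae_tendsto_spread hn, ae_all_iff.2 hX.step,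
      ae_all_iff.2 fun q : ℚ => hX.ae_tendsto_average_insert q] with ω hω hs hstep hq
    exact BeautyContest.tendsto_leftProportion hn (u := fun t => U t ω)
      ⟨le_max_left _ _, max_le zero_le_one (min_le_left _ _)⟩ hstep hs hω hq
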